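/- Let $(Q,\mathfrak n)$ be a regular local ring containing a field, of dimension $d$, and let $x_1,\dots,x_d$ be a regular system of parameters, i.e. $d=\dim Q$ elements generating $\mathfrak n$. Let $I\subseteq Q$ be an $\mathfrak n$-primary ideal generated by monomials in $x_1,\dots,x_d$. Suppose that there are indices $i,j,l$ with $j\neq l$ (where $i=j$ or $i=l$ is allowed) such that $x_ix_j\in I$ and $x_ix_l\in I$, while none of $x_i,x_j,x_l$ lies in $I$ (the last condition holds automatically if $I\subseteq\mathfrak n^2$). Then the canonical module $\omega$ of the local ring $R=Q/I$ grows exponentially: if $b_n$ denotes the rank of the $n$-th free module in a minimal free resolution of $\omega$ over $R$, then there are real numbers $1<\alpha<\beta$ such that $\alpha^n<b_n<\beta^n$ for all sufficiently large $n$. Here a canonical module of a Cohen--Macaulay local ring $R$ is a maximal Cohen--Macaulay $R$-module $\omega$ of finite injective dimension for which the natural homomorphism $R\to\operatorname{Hom}_R(\omega,\omega)$ is an isomorphism; it is unique up to isomorphism when it exists. -/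

import Mathlib

open IsLocalRing CategoryTheory

universe u

/-- `x₁, …, x_d` is a regular system of parameters of the local ring `Q`: a system of
`d = dim Q` elements that generates the maximal ideal. -/
def IsRegularSystemOfParameters {Q : Type u} [CommRing Q] [IsLocalRing Q] {d : ℕ}
    (x : Fin d → Q) : Prop :=
  Ideal.span (Set.range x) = maximalIdeal Q ∧ (d : WithBot ℕ∞) = ringKrullDim Q

/-- The ideal `I` is generated by monomials `x₁ ^ a₁ ⋯ x_d ^ a_d`. -/
def IsMonomialIdeal {Q : Type u} [CommRing Q] {d : ℕ} (x : Fin d → Q) (I : Ideal Q) : Prop :=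
  ∃ A : Set (Fin d → ℕ), I = Ideal.span ((fun a => ∏ t, x t ^ a t) '' A)

/-- `I` is primary to the maximal ideal. -/
def IsMaximalIdealPrimary {Q : Type u} [CommRing Q] [IsLocalRing Q] (I : Ideal Q) : Prop :=
  I.IsPrimary ∧ I.radical = maximalIdeal Q

/-- The quotient by an ideal primary to the maximal ideal is again a local ring. -/
theorem IsMaximalIdealPrimary.isLocalRing_quotient {Q : Type u} [CommRing Q] [IsLocalRing Q]
    {I : Ideal Q} (h : IsMaximalIdealPrimary I) : IsLocalRing (Q ⧸ I) := by
  have : Nontrivial (Q ⧸ I) := Ideal.Quotient.nontrivial_iff.mpr h.1.ne_top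
  exact IsLocalRing.of_surjective' (Ideal.Quotient.mk I) Ideal.Quotient.mk_surjective

/-- A finitely generated module over a Noetherian local ring `R` is maximal Cohen–Macaulay if
its depth is `dim R`, i.e. if the maximal ideal contains an `M`-regular sequence of length
`dim R` (the depth never exceeds `dim R`). Regularity of a sequence includes `M ≠ (rs) M`, so
`M` is nonzero. -/
def IsMaximalCohenMacaulay (R : Type u) [CommRing R] [IsLocalRing R]
    (M : Type u) [AddCommGroup M] [Module R M] : Prop :=
  Module.Finite R M ∧
    ∃ rs : List R, (∀ r ∈ rs, r ∈ maximalIdeal R) ∧ RingTheory.Sequence.IsRegular M rs ∧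
      (rs.length : WithBot ℕ∞) = ringKrullDim R

/-- `M` is a canonical module of the local ring `R`: it is maximal Cohen–Macaulay, it has finite
injective dimension, and the homothety map `R → Hom_R(M, M)` is an isomorphism. -/
structure IsCanonicalModule (R : Type u) [CommRing R] [IsLocalRing R]
    (M : Type u) [AddCommGroup M] [Module R M] : Prop where
  isMaximalCohenMacaulay : IsMaximalCohenMacaulay R M
  finite_injectiveDimension : ∃ n : ℕ, HasInjectiveDimensionLE (ModuleCat.of R M) n
  bijective_homothety : Function.Bijective (algebraMap R (Module.End R M))

/-- A minimal free resolution `⋯ → R ^ b₂ → R ^ b₁ → R ^ b₀ → M → 0`, by free modules of finite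
rank; minimality says that each differential maps into the maximal ideal times its target. -/
structure MinimalFreeResolution (R : Type u) [CommRing R] [IsLocalRing R]
    (M : Type u) [AddCommGroup M] [Module R M] where
  rank : ℕ → ℕ
  diff : ∀ i : ℕ, (Fin (rank (i + 1)) → R) →ₗ[R] (Fin (rank i) → R)
  aug : (Fin (rank 0) → R) →ₗ[R] M
  aug_surjective : Function.Surjective aug
  exact_aug : Function.Exact (diff 0) aug
  exact_diff : ∀ i : ℕ, Function.Exact (diff (i + 1)) (diff i)
  minimal : ∀ i : ℕ,
    LinearMap.range (diff i) ≤ maximalIdeal R • (⊤ : Submodule R (Fin (rank i) → R))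

/-- The sequence `b` has exponential growth: there are real numbers `1 < α < β` with
`α ^ i < b i < β ^ i` for all large `i`. -/
def HasExponentialGrowth (b : ℕ → ℕ) : Prop :=
  ∃ α β : ℝ, 1 < α ∧ α < β ∧
    ∀ᶠ i : ℕ in Filter.atTop, α ^ i < (b i : ℝ) ∧ (b i : ℝ) < β ^ i

/-- The module `M` grows exponentially: its Betti numbers, the ranks of the free modules in a
minimal free resolution (unique up to isomorphism), have exponential growth. -/
def GrowsExponentially (R : Type u) [CommRing R] [IsLocalRing R]
    (M : Type u) [AddCommGroup M] [Module R M] : Prop :=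
  ∃ F : MinimalFreeResolution R M, HasExponentialGrowth F.rank

/-! Over the Artinian ring `R = Q ⧸ I`, finite injective dimension forces `ω` to be injective. One
of `j`, `l` differs from `i`; among monomials outside `I` free of `x i` but divisible by that second
variable, one of largest degree is a socle element `s` of `R`, and `s ∉ (x i)` because `I` is
monomial. Injectivity extends a map `R s̄ → ω`, with `s̄` the class of `s` in `R ⧸ (x i)`, to `R ⧸
(x i) → ω`. The image `u` of `1` is killed by `x i`, and `s • u ≠ 0` while `s` kills `𝔪 ω`, so `u`
is a minimal generator (`Module.Injective.exists_smul_eq_zero`).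

Put `p = x i`, `q = x j`, `r = x l`, so `p q = p r = 0` in `R`. In a minimal resolution, if `d f = p
e` then `q f` and `r f` are cycles, hence `d g = q f` and `d h = r f`; then `p g` and `p h` are
again boundaries. Since `d` maps `𝔪 F` into `𝔪² F` and `q`, `r` are independent modulo `𝔪²`, the
vectors `g`, `h` stay independent modulo `𝔪`. Starting from a lift of `u`, the family doubles every
two steps, so `b n ≥ 2 ^ (n / 2)`. The upper bound comes from the finite length of `R`. -/

/-! ### Regular local rings: regular quotients and integrality. -/

theorem spanFinrank_maximalIdeal_quotient_le {Q : Type u} [CommRing Q] [IsLocalRing Q]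
    (S T : Finset Q) (hST : Ideal.span ((S : Set Q) ∪ T) = maximalIdeal Q)
    [IsLocalRing (Q ⧸ Ideal.span (S : Set Q))] :
    (maximalIdeal (Q ⧸ Ideal.span (S : Set Q))).spanFinrank ≤ T.card := by
  have hmax : maximalIdeal (Q ⧸ Ideal.span (S : Set Q)) =
      Ideal.span (Ideal.Quotient.mk (Ideal.span (S : Set Q)) '' T) := by
    rw [← IsLocalRing.map_maximalIdeal_of_surjective (Ideal.Quotient.mk _)
      Ideal.Quotient.mk_surjective, ← hST, Ideal.map_span, Set.image_union, Ideal.span_union]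
    refine sup_eq_right.mpr ?_
    rw [← Ideal.map_span, Ideal.map_quotient_self]
    exact bot_le
  rw [hmax]
  refine (Submodule.spanFinrank_span_le_ncard_of_finite (T.finite_toSet.image _)).trans ?_
  exact (Set.ncard_image_le T.finite_toSet).trans (by simp)

/-- Killing `S` lowers the dimension by at most `S.card`, while the images of `T` generate the new
maximal ideal; so the embedding dimension cannot exceed the dimension. -/
theorem isRegularLocalRing_quotient_span {Q : Type u} [CommRing Q] [IsRegularLocalRing Q]
    (S T : Finset Q) (hST : Ideal.span ((S : Set Q) ∪ T) = maximalIdeal Q)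
    (hcard : S.card + T.card ≤ (maximalIdeal Q).spanFinrank) :
    IsRegularLocalRing (Q ⧸ Ideal.span (S : Set Q)) := by
  have hSm : Ideal.span (S : Set Q) ≤ maximalIdeal Q :=
    hST ▸ Ideal.span_mono Set.subset_union_left
  have hne : Ideal.span (S : Set Q) ≠ ⊤ := fun h =>
    (maximalIdeal.isMaximal Q).ne_top (top_le_iff.mp (h ▸ hSm))
  have : Nontrivial (Q ⧸ Ideal.span (S : Set Q)) := Ideal.Quotient.nontrivial_iff.mpr hne
  have : IsLocalRing (Q ⧸ Ideal.span (S : Set Q)) :=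
    IsLocalRing.of_surjective' (Ideal.Quotient.mk _) Ideal.Quotient.mk_surjective
  apply IsRegularLocalRing.of_spanFinrank_maximalIdeal_le
  have h1 := spanFinrank_maximalIdeal_quotient_le S T hST
  have h2 : ringKrullDim Q ≤ ringKrullDim (Q ⧸ Ideal.span (S : Set Q)) + S.card := by
    apply ringKrullDim_le_ringKrullDim_quotient_add_card
    rw [IsLocalRing.ringJacobson_eq_maximalIdeal]
    exact fun s hs => hSm (Ideal.subset_span hs)
  rw [← IsRegularLocalRing.spanFinrank_maximalIdeal] at h2
  obtain ⟨n, hn⟩ : ∃ n : ℕ, ringKrullDim (Q ⧸ Ideal.span (S : Set Q)) = n := by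
    have := ringKrullDim_lt_top (R := Q ⧸ Ideal.span (S : Set Q))
    have h0 := ringKrullDim_nonneg_of_nontrivial (R := Q ⧸ Ideal.span (S : Set Q))
    generalize ringKrullDim (Q ⧸ Ideal.span (S : Set Q)) = e at this h0
    induction e with
    | bot => simp at h0
    | coe e => 
      induction e with
      | top => exact absurd this (lt_irrefl _)
      | coe e => exact ⟨e, rfl⟩
  rw [hn] at h2 ⊢
  norm_cast at h2 ⊢
  omega

/-- A regular local ring is an integral domain. -/
theorem IsRegularLocalRing.isDomain_of_spanFinrank_le (n : ℕ) :
    ∀ (Q : Type u) [CommRing Q] [IsRegularLocalRing Q],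
      (maximalIdeal Q).spanFinrank ≤ n → IsDomain Q := by
  classical
  induction n with
  | zero =>
    intro Q _ _ h
    rw [Nat.le_zero, Submodule.spanFinrank_eq_zero_iff_eq_bot (IsNoetherian.noetherian _)] at h
    exact (IsLocalRing.isField_iff_maximalIdeal_eq.mpr h).isDomain
  | succ n ih =>
    intro Q _ _ h
    by_cases hbot : maximalIdeal Q = ⊥
    · exact (IsLocalRing.isField_iff_maximalIdeal_eq.mpr hbot).isDomain
    have hfin := minimalPrimes.finite_of_isNoetherianRing Q
    obtain ⟨x, hxm, hx2, hxp⟩ : ∃ x ∈ maximalIdeal Q, x ∉ maximalIdeal Q ^ 2 ∧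
        ∀ p ∈ minimalPrimes Q, x ∉ p := by
      by_contra! hcon
      have hsub : (maximalIdeal Q : Set Q) ⊆
          ⋃ i ∈ ((insert (maximalIdeal Q ^ 2) hfin.toFinset : Finset (Ideal Q)) : Set (Ideal Q)),
            (i : Set Q) := by
        intro y hy
        by_cases hy2 : y ∈ maximalIdeal Q ^ 2
        · exact Set.mem_biUnion (by simp) hy2
        · obtain ⟨p, hp, hyp⟩ := hcon y hy hy2
          exact Set.mem_biUnion (x := p) (by simp [hp]) hyp
      -- Prime avoidance tolerates two non-prime ideals; `𝔪²` fills both slots. Nakayama excludes `𝔪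
      -- ≤ 𝔪²`, and positive dimension excludes `𝔪` being a minimal prime.
      rw [Ideal.subset_union_prime (maximalIdeal Q ^ 2) (maximalIdeal Q ^ 2)] at hsub
      · obtain ⟨p, hp, hle⟩ := hsub
        rw [Finset.mem_insert] at hp
        rcases hp with rfl | hp
        · apply hbot
          apply Submodule.eq_bot_of_le_smul_of_le_jacobson_bot (maximalIdeal Q) (maximalIdeal Q)
            (IsNoetherian.noetherian _)
          · rwa [smul_eq_mul, ← pow_two]
          · rw [IsLocalRing.jacobson_eq_maximalIdeal _ bot_ne_top]
        · have hp := hfin.mem_toFinset.mp hp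
          have hpp : p.IsPrime := hp.1.1
          have hpm : maximalIdeal Q = p :=
            (maximalIdeal.isMaximal Q).eq_of_le hp.1.1.ne_top hle
          have := IsLocalRing.maximalIdeal_height_eq_ringKrullDim (R := Q)
          rw [← IsRegularLocalRing.spanFinrank_maximalIdeal, hpm,
            Ideal.height_eq_zero_iff.mpr hp] at this
          norm_cast at this
          rw [eq_comm, Submodule.spanFinrank_eq_zero_iff_eq_bot (IsNoetherian.noetherian _),
            ← hpm] at this
          exact hbot this
      · intro i hi hi1 _
        rw [Finset.mem_insert] at hi
        exact (hfin.mem_toFinset.mp (hi.resolve_left hi1)).1.1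
    obtain ⟨S', hS'card, hS'span⟩ := Submodule.FG.exists_span_set_encard_eq_spanFinrank
      (IsNoetherian.noetherian (maximalIdeal Q))
    have hS'fin : S'.Finite := Set.finite_of_encard_eq_coe hS'card
    lift S' to Finset Q using hS'fin with S
    rw [Set.encard_coe_eq_coe_finsetCard, Nat.cast_inj] at hS'card
    have hSm : ∀ s ∈ S, s ∈ maximalIdeal Q := fun s hs => by
      rw [← hS'span]; exact Submodule.subset_span hs
    obtain ⟨c, hc⟩ : ∃ c : Q → Q, ∑ s ∈ S, c s * s = x := by
      have := hxm
      rw [← hS'span, Submodule.mem_span_finset] at this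
      obtain ⟨c, -, hc⟩ := this
      exact ⟨c, hc⟩
    obtain ⟨s, hsS, hs⟩ : ∃ s ∈ S, IsUnit (c s) := by
      by_contra! hcon
      apply hx2
      rw [← hc, pow_two]
      exact Ideal.sum_mem _ fun s hs => Ideal.mul_mem_mul
        ((mem_maximalIdeal _).mpr (hcon s hs)) (hSm s hs)
    -- As `c s` is a unit, `x` can replace `s` in the minimal generating set.
    have hspan : Ideal.span ((({x} : Finset Q) : Set Q) ∪ (S.erase s : Finset Q)) =
        maximalIdeal Q := by
      apply le_antisymm
      · rw [Ideal.span_le]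
        rintro y (hy | hy)
        · rw [Finset.coe_singleton, Set.mem_singleton_iff] at hy
          exact hy ▸ hxm
        · exact hSm y (Finset.mem_of_mem_erase hy)
      · rw [← hS'span]
        change Ideal.span _ ≤ _
        rw [Ideal.span_le]
        intro y hy
        by_cases hys : y = s
        · subst hys
          rw [← Finset.add_sum_erase S _ hsS] at hc
          have : c y * y = x - ∑ z ∈ S.erase y, c z * z := by rw [← hc]; ring
          rw [SetLike.mem_coe, ← Ideal.unit_mul_mem_iff_mem _ hs, this]
          refine Ideal.sub_mem _ (Ideal.subset_span (Or.inl (by simp))) (Ideal.sum_mem _ ?_)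
          exact fun z hz => Ideal.mul_mem_left _ _ (Ideal.subset_span (Or.inr hz))
        · exact Ideal.subset_span (Or.inr (Finset.mem_coe.mpr (Finset.mem_erase.mpr ⟨hys, hy⟩)))
    have hcard : (S.erase s).card + 1 = S.card := Finset.card_erase_add_one hsS
    have hreg := isRegularLocalRing_quotient_span {x} (S.erase s) hspan
      (by rw [Finset.card_singleton]; omega)
    have hdom := ih _ ((spanFinrank_maximalIdeal_quotient_le {x} (S.erase s) hspan).trans (by omega))
    rw [Finset.coe_singleton, Ideal.Quotient.isDomain_iff_prime] at hdom
    -- By induction `(x)` is prime, so it contains a minimal prime `q`. Since `x ∉ q`, any `a * x ∈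
    -- q` has `a ∈ q`; thus `q ≤ 𝔪 q`, and Nakayama gives `q = ⊥`.
    obtain ⟨q, hq, hqx⟩ := Ideal.exists_minimalPrimes_le (bot_le : ⊥ ≤ Ideal.span {x})
    have hqp : q.IsPrime := hq.1.1
    have hq0 : q = ⊥ := by
      apply Submodule.eq_bot_of_le_smul_of_le_jacobson_bot (maximalIdeal Q) q
        (IsNoetherian.noetherian _)
      · intro y hy
        obtain ⟨a, rfl⟩ := Ideal.mem_span_singleton'.mp (hqx hy)
        rw [mul_comm]
        exact Submodule.smul_mem_smul hxm ((hqp.mem_or_mem hy).resolve_right (hxp q hq))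
      · rw [IsLocalRing.jacobson_eq_maximalIdeal _ bot_ne_top]
    have : (⊥ : Ideal Q).IsPrime := hq0 ▸ hqp
    exact IsDomain.of_bot_isPrime Q

/-! ### Regular systems of parameters and their powers. -/

section RegularSystem

variable {Q : Type u} [CommRing Q] [IsRegularLocalRing Q] {d : ℕ} {x : Fin d → Q}

theorem IsRegularSystemOfParameters.spanFinrank_eq (hx : IsRegularSystemOfParameters x) :
    (maximalIdeal Q).spanFinrank = d := by
  have := hx.2
  rw [← IsRegularLocalRing.spanFinrank_maximalIdeal] at this
  exact_mod_cast this.symm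

theorem IsRegularSystemOfParameters.not_maximalIdeal_le (hx : IsRegularSystemOfParameters x)
    (t : Fin d) : ¬ maximalIdeal Q ≤ Ideal.span (x '' {t}ᶜ) := by
  intro h
  have h1 : maximalIdeal Q = Ideal.span (x '' {t}ᶜ) :=
    le_antisymm h (hx.1 ▸ Ideal.span_mono (Set.image_subset_range _ _))
  have h2 := hx.spanFinrank_eq
  have h3 := Submodule.spanFinrank_span_le_ncard_of_finite (R := Q)
    (Set.toFinite (x '' {t}ᶜ))
  have h4 : (x '' {t}ᶜ).ncard ≤ ({t}ᶜ : Set (Fin d)).ncard := Set.ncard_image_le (Set.toFinite _)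
  have h5 := Set.ncard_add_ncard_compl ({t} : Set (Fin d))
  rw [Set.ncard_singleton, Nat.card_eq_fintype_card, Fintype.card_fin] at h5
  rw [h1] at h2
  change Submodule.spanFinrank (Submodule.span Q _) = d at h2
  omega

theorem IsRegularSystemOfParameters.maximalIdeal_le_of_mem (hx : IsRegularSystemOfParameters x)
    {t : Fin d} {J : Ideal Q} (ht : x t ∈ J) (hJ : ∀ s ≠ t, x s ∈ J) : maximalIdeal Q ≤ J := by
  rw [← hx.1, Ideal.span_le]
  rintro _ ⟨s, rfl⟩
  by_cases h : s = t
  · exact h ▸ ht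
  · exact hJ s h

theorem IsRegularSystemOfParameters.notMem_span (hx : IsRegularSystemOfParameters x)
    {S : Set (Fin d)} {t : Fin d} (ht : t ∉ S) : x t ∉ Ideal.span (x '' S) := fun h =>
  hx.not_maximalIdeal_le t <| hx.maximalIdeal_le_of_mem
    (Ideal.span_mono (Set.image_mono (by simpa using ht)) h)
    fun _ hs => Ideal.subset_span ⟨_, hs, rfl⟩

theorem IsRegularSystemOfParameters.isPrime_span (hx : IsRegularSystemOfParameters x)
    (S : Finset (Fin d)) : (Ideal.span (x '' S)).IsPrime := by
  classical
  have hspan : Ideal.span (((S.image x : Finset Q) : Set Q) ∪ (Sᶜ.image x : Finset Q)) =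
      maximalIdeal Q := by
    rw [← hx.1]
    congr 1
    push_cast
    rw [← Set.image_union, Set.union_compl_self, Set.image_univ]
  have hreg := isRegularLocalRing_quotient_span (S.image x) (Sᶜ.image x) hspan (by
    rw [hx.spanFinrank_eq]
    have h1 := Finset.card_image_le (s := S) (f := x)
    have h2 := Finset.card_image_le (s := Sᶜ) (f := x)
    have h3 := S.card_add_card_compl
    rw [Fintype.card_fin] at h3
    omega)
  have := IsRegularLocalRing.isDomain_of_spanFinrank_le _
    (Q ⧸ Ideal.span ((S.image x : Finset Q) : Set Q)) le_rfl
  rw [Ideal.Quotient.isDomain_iff_prime] at this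
  simpa using this

/-- A multiple of `x t` lying in an ideal generated by powers of the other parameters has its
cofactor in that ideal. -/
theorem IsRegularSystemOfParameters.mem_of_mul_mem (hx : IsRegularSystemOfParameters x) (n : ℕ) :
    ∀ (S : Finset (Fin d)) (c : Fin d → ℕ), (∀ s ∈ S, 1 ≤ c s) → ∑ s ∈ S, c s ≤ n →
      ∀ t ∉ S, ∀ y : Q, x t * y ∈ Ideal.span ((fun s => x s ^ c s) '' S) →
        y ∈ Ideal.span ((fun s => x s ^ c s) '' S) := by
  classical
  induction n with
  | zero =>
    intro S c hc hn t ht y hy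
    have hS : S = ∅ := by
      rw [Finset.eq_empty_iff_forall_notMem]
      intro s hs
      have := Finset.single_le_sum (f := c) (fun _ _ => Nat.zero_le _) hs
      have := hc s hs
      omega
    subst hS
    have hp := hx.isPrime_span ∅
    have hnot := hx.notMem_span (S := ((∅ : Finset (Fin d)) : Set (Fin d))) (t := t) (by simp)
    simp only [Finset.coe_empty, Set.image_empty] at hp hnot hy ⊢
    exact (hp.mem_or_mem hy).resolve_left hnot
  | succ n ih =>
    intro S c hc hn t ht y hy
    by_cases h1 : ∀ s ∈ S, c s = 1
    · have himg : (fun s => x s ^ c s) '' (S : Set (Fin d)) = x '' S :=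
        Set.image_congr fun s hs => by rw [h1 s hs, pow_one]
      rw [himg] at hy ⊢
      exact ((hx.isPrime_span S).mem_or_mem hy).resolve_left (hx.notMem_span (by simpa using ht))
    -- Some exponent is at least 2, the ideal of parameters being prime otherwise. With that
    -- exponent equal to `k + 1`, write `y = u * x s ^ k + j`; cancelling `x s ^ k` modulo `J` puts
    -- `x t * u` in `(x s) + J`, so `u` lies there too and `y` gains the missing factor. Each appeal
    -- to induction has a smaller exponent sum.
    push Not at h1
    obtain ⟨s, hs, hs1⟩ := h1
    have hcs := hc s hs
    have hsum : c s + ∑ r ∈ S.erase s, c r = ∑ r ∈ S, c r := Finset.add_sum_erase S c hs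
    set J := Ideal.span ((fun r => x r ^ c r) '' (S.erase s : Finset (Fin d))) with hJ
    have hsplit : ∀ m : ℕ, Ideal.span ((fun r => x r ^ Function.update c s m r) '' S) =
        Ideal.span {x s ^ m} ⊔ J := by
      intro m
      conv_lhs => rw [← Finset.insert_erase hs]
      rw [Finset.coe_insert, Set.image_insert_eq, Ideal.span_insert, Function.update_self]
      congr 2
      refine Set.image_congr fun r hr => ?_
      rw [Function.update_of_ne (Finset.ne_of_mem_erase (Finset.mem_coe.mp hr))]
    have hstep : ∀ m : ℕ, 1 ≤ m → m < c s → ∀ z : Q,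
        x t * z ∈ Ideal.span {x s ^ m} ⊔ J → z ∈ Ideal.span {x s ^ m} ⊔ J := by
      intro m hm hmc z hz
      rw [← hsplit m] at hz ⊢
      refine ih S (Function.update c s m) ?_ ?_ t ht z hz
      · intro r hr
        by_cases hrs : r = s
        · subst hrs; simpa using hm
        · rw [Function.update_of_ne hrs]; exact hc r hr
      · have h0 : ∑ r ∈ S.erase s, Function.update c s m r = ∑ r ∈ S.erase s, c r :=
          Finset.sum_congr rfl fun r hr => Function.update_of_ne (Finset.ne_of_mem_erase hr) m c
        rw [← Finset.add_sum_erase S _ hs, Function.update_self, h0]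
        omega
    have hsJ : ∀ (k : ℕ) (z : Q), x s ^ k * z ∈ J → z ∈ J := by
      intro k
      induction k with
      | zero => intro z hz; simpa using hz
      | succ k ihk =>
        intro z hz
        rw [pow_succ, mul_assoc] at hz
        exact ih (S.erase s) c (fun r hr => hc r (Finset.mem_of_mem_erase hr)) (by omega) s
          (Finset.notMem_erase s S) z (ihk _ hz)
    have hself : Ideal.span ((fun r => x r ^ c r) '' S) = Ideal.span {x s ^ c s} ⊔ J := by
      rw [← hsplit, Function.update_eq_self]
    rw [hself] at hy ⊢
    obtain ⟨k, hk⟩ : ∃ k, c s = k + 1 := ⟨c s - 1, by omega⟩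
    rw [hk] at hy ⊢
    have hle : Ideal.span {x s ^ (k + 1)} ≤ Ideal.span {x s ^ k} :=
      Ideal.span_singleton_le_span_singleton.mpr (pow_dvd_pow _ k.le_succ)
    have hy1 : x t * y ∈ Ideal.span {x s ^ k} ⊔ J := (sup_le_sup_right hle J :) hy
    obtain ⟨a, ha, j, hj, hy2⟩ := Submodule.mem_sup.mp (hstep k (by omega) (by omega) y hy1)
    obtain ⟨u, rfl⟩ := Ideal.mem_span_singleton'.mp ha
    obtain ⟨b, hb, j', hj', hy3⟩ := Submodule.mem_sup.mp hy
    obtain ⟨v, rfl⟩ := Ideal.mem_span_singleton'.mp hb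
    have h2 : x t * u - v * x s ∈ J := by
      apply hsJ k
      have : x s ^ k * (x t * u - v * x s) = j' - x t * j := by
        rw [← hy2] at hy3
        linear_combination (-1 : Q) * hy3
      rw [this]
      exact J.sub_mem hj' (J.mul_mem_left _ hj)
    have h3 : u ∈ Ideal.span {x s ^ 1} ⊔ J := by
      apply hstep 1 le_rfl (by omega)
      have : x t * u = v * x s ^ 1 + (x t * u - v * x s) := by ring
      rw [this]
      exact Submodule.add_mem_sup (Ideal.mem_span_singleton'.mpr ⟨v, rfl⟩) h2
    obtain ⟨b, hb, j'', hj'', hu⟩ := Submodule.mem_sup.mp h3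
    obtain ⟨w, rfl⟩ := Ideal.mem_span_singleton'.mp hb
    have : y = w * x s ^ (k + 1) + (j'' * x s ^ k + j) := by
      rw [← hy2, ← hu]; ring
    rw [this]
    exact Submodule.add_mem_sup (Ideal.mem_span_singleton'.mpr ⟨w, rfl⟩)
      (J.add_mem (J.mul_mem_right _ hj'') hj)

/-- Raise the exponents one variable at a time, starting from `1 ∉ 𝔪`. At each step `x t ^ a t` can
be cancelled modulo the powers of the other parameters, which would bring back the previous case. -/
theorem IsRegularSystemOfParameters.prod_pow_notMem (hx : IsRegularSystemOfParameters x)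
    (a : Fin d → ℕ) : ∏ t, x t ^ a t ∉ Ideal.span (Set.range fun t => x t ^ (a t + 1)) := by
  classical
  have key : ∀ T : Finset (Fin d), ∏ t ∈ T, x t ^ a t ∉
      Ideal.span (Set.range fun t => x t ^ (if t ∈ T then a t + 1 else 1)) := by
    intro T
    induction T using Finset.induction_on with
    | empty =>
      simp only [Finset.prod_empty, Finset.notMem_empty, if_false, pow_one]
      rw [← Ideal.eq_top_iff_one, hx.1]
      exact (maximalIdeal.isMaximal Q).ne_top
    | insert t T ht ih =>
      intro hmem
      apply ih
      rw [Finset.prod_insert ht] at hmem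
      set c : Fin d → ℕ := fun s => if s ∈ T then a s + 1 else 1 with hc
      set J := Ideal.span ((fun s => x s ^ c s) '' ((Finset.univ.erase t : Finset (Fin d)) :
        Set (Fin d))) with hJ
      have hsplit : ∀ c' : Fin d → ℕ, (∀ s ≠ t, c' s = c s) →
          Ideal.span (Set.range fun s => x s ^ c' s) = Ideal.span {x t ^ c' t} ⊔ J := by
        intro c' hc'
        rw [← Set.image_univ, ← Finset.coe_univ, ← Finset.insert_erase (Finset.mem_univ t),
          Finset.coe_insert, Set.image_insert_eq, Ideal.span_insert, hJ]
        congr 2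
        exact Set.image_congr fun s hs => by
          rw [hc' s (Finset.ne_of_mem_erase (Finset.mem_coe.mp hs))]
      rw [hsplit _ (fun s hs => by simp [hc, hs])] at hmem
      rw [hsplit c (fun _ _ => rfl)]
      simp only [Finset.mem_insert_self, if_true] at hmem
      obtain ⟨b, hb, j, hj, hy⟩ := Submodule.mem_sup.mp hmem
      obtain ⟨v, rfl⟩ := Ideal.mem_span_singleton'.mp hb
      have hcol : ∀ (k : ℕ) (z : Q), x t ^ k * z ∈ J → z ∈ J := by
        intro k
        induction k with
        | zero => intro z hz; simpa using hz
        | succ k ihk =>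
          intro z hz
          rw [pow_succ, mul_assoc] at hz
          refine hx.mem_of_mul_mem _ (Finset.univ.erase t) c (fun s _ => ?_) le_rfl t
            (Finset.notMem_erase t _) z (ihk _ hz)
          simp only [hc]; split_ifs <;> omega
      have h2 : ∏ s ∈ T, x s ^ a s - v * x t ∈ J := by
        apply hcol (a t)
        have : x t ^ a t * (∏ s ∈ T, x s ^ a s - v * x t) = j := by
          linear_combination (-1 : Q) * hy
        rwa [this]
      have h3 : ∏ s ∈ T, x s ^ a s = v * x t ^ c t + (∏ s ∈ T, x s ^ a s - v * x t) := by
        simp [hc, ht]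
      rw [h3]
      exact Submodule.add_mem_sup (Ideal.mem_span_singleton'.mpr ⟨v, rfl⟩) h2
  simpa using key Finset.univ

/-- By Nakayama, the class of `x t` in `𝔪 / 𝔪²` is not a combination of those of the other
parameters. -/
theorem IsRegularSystemOfParameters.mem_maximalIdeal_of_mul_mem
    (hx : IsRegularSystemOfParameters x) {t : Fin d} {u : Q}
    (h : u * x t ∈ Ideal.span (x '' {t}ᶜ) ⊔ maximalIdeal Q ^ 2) : u ∈ maximalIdeal Q := by
  by_contra hu
  have hu : IsUnit u := by simpa using hu
  rw [Ideal.unit_mul_mem_iff_mem _ hu] at h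
  apply hx.not_maximalIdeal_le t
  apply Submodule.le_of_le_smul_of_le_jacobson_bot (I := maximalIdeal Q) (IsNoetherian.noetherian _)
  · rw [IsLocalRing.jacobson_eq_maximalIdeal _ bot_ne_top]
  · rw [smul_eq_mul, ← pow_two]
    exact hx.maximalIdeal_le_of_mem h fun s hs =>
      Ideal.mem_sup_left (Ideal.subset_span ⟨s, hs, rfl⟩)

end RegularSystem

/-! ### Monomial ideals: socle elements and linear independence. -/

section MonomialIdeal

variable {Q : Type u} [CommRing Q] [IsRegularLocalRing Q] {d : ℕ} {x : Fin d → Q} {I : Ideal Q}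

theorem IsRegularSystemOfParameters.mem_maximalIdeal (hx : IsRegularSystemOfParameters x)
    (t : Fin d) : x t ∈ maximalIdeal Q :=
  hx.1 ▸ Ideal.subset_span ⟨t, rfl⟩

/-- No generating monomial of `I` divides the given one, so each is divisible by some `x t ^ (a t +
1)`; so is `x i`, as `a i = 0`. Hence `prod_pow_notMem` applies. -/
theorem IsMonomialIdeal.prod_pow_notMem_span_sup (hx : IsRegularSystemOfParameters x)
    (hmon : IsMonomialIdeal x I) {a : Fin d → ℕ} (ha : ∏ t, x t ^ a t ∉ I) {i : Fin d}
    (hi : a i = 0) : ∏ t, x t ^ a t ∉ Ideal.span {x i} ⊔ I := by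
  obtain ⟨A, hA⟩ := hmon
  refine fun h => hx.prod_pow_notMem a ((?_ : Ideal.span {x i} ⊔ I ≤ _) h)
  refine sup_le ?_ ?_
  · rw [Ideal.span_singleton_le_iff_mem]
    exact Ideal.subset_span ⟨i, by simp [hi]⟩
  · rw [hA, Ideal.span_le]
    rintro _ ⟨b, hb, rfl⟩
    have hbI : ∏ t, x t ^ b t ∈ I := hA ▸ Ideal.subset_span ⟨b, hb, rfl⟩
    obtain ⟨t, ht⟩ : ∃ t, a t < b t := by
      by_contra! hle
      exact ha (I.mem_of_dvd (Finset.prod_dvd_prod_of_dvd _ _ fun t _ => pow_dvd_pow _ (hle t)) hbI)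
    refine Ideal.mem_of_dvd _ ?_ (Ideal.subset_span ⟨t, rfl⟩)
    exact (pow_dvd_pow _ ht).trans (Finset.dvd_prod_of_mem (fun t => x t ^ b t) (Finset.mem_univ t))

/-- If `x i * x l` lies in the monomial ideal `I` and `x l` does not, then the quotient by `I`
has a socle element outside the ideal generated by `x i`. -/
theorem IsMonomialIdeal.exists_socle_notMem (hx : IsRegularSystemOfParameters x)
    (hI : IsMaximalIdealPrimary I) (hmon : IsMonomialIdeal x I) {i l : Fin d} (hil : i ≠ l)
    (hmem : x i * x l ∈ I) (hl : x l ∉ I) :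
    ∃ s : Q, s ∉ Ideal.span {x i} ⊔ I ∧ ∀ y ∈ maximalIdeal Q, y * s ∈ I := by
  classical
  obtain ⟨N, hN⟩ := I.exists_radical_pow_le_of_fg (IsNoetherian.noetherian _)
  rw [hI.2] at hN
  -- A monomial realizing the largest such degree is the socle element: multiplication by `x i`
  -- gives a multiple of `x i * x l`, and any other variable would raise the degree. The bound is `𝔪
  -- ^ N ≤ I`.
  let P : ℕ → Prop := fun n => ∃ a : Fin d → ℕ, a i = 0 ∧ 1 ≤ a l ∧ ∏ t, x t ^ a t ∉ I ∧
    ∑ t, a t = n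
  have hPle : ∀ n, P n → n ≤ N := by
    rintro n ⟨a, -, -, ha, rfl⟩
    by_contra! hlt
    apply ha (hN (Ideal.pow_le_pow_right hlt.le _))
    rw [← Finset.prod_pow_eq_pow_sum]
    exact Ideal.prod_mem_prod fun t _ => Ideal.pow_mem_pow (hx.mem_maximalIdeal t) _
  have hP1 : P 1 := ⟨Pi.single l 1, by simp [hil], by simp, by
    rw [Finset.prod_eq_single l (fun t _ ht => by simp [ht]) (by simp)]; simpa using hl, by simp⟩
  obtain ⟨a, hai, hal, haI, hsum⟩ := Nat.findGreatest_spec (P := P) (hPle 1 hP1) hP1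
  refine ⟨∏ t, x t ^ a t, hmon.prod_pow_notMem_span_sup hx haI hai, ?_⟩
  suffices h : maximalIdeal Q ≤ I.colon {∏ t, x t ^ a t} by
    intro y hy
    simpa [Submodule.mem_colon_singleton] using h hy
  rw [← hx.1, Ideal.span_le]
  rintro _ ⟨t, rfl⟩
  rw [SetLike.mem_coe, Submodule.mem_colon_singleton, smul_eq_mul]
  by_cases hti : t = i
  · subst hti
    refine I.mem_of_dvd (mul_dvd_mul_left _ ?_) hmem
    exact (dvd_pow_self _ (by omega)).trans
      (Finset.dvd_prod_of_mem (fun t => x t ^ a t) (Finset.mem_univ l))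
  · by_contra hcon
    have hprod : ∏ s, x s ^ (a + Pi.single t 1 : Fin d → ℕ) s = x t * ∏ s, x s ^ a s := by
      simp only [Pi.add_apply, pow_add, Finset.prod_mul_distrib]
      rw [mul_comm, Finset.prod_eq_single (f := fun s => x s ^ (Pi.single t 1 : Fin d → ℕ) s) t
        (fun s _ hs => by simp [hs]) (by simp)]
      simp
    have hP : P (∑ s, a s + 1) := ⟨a + Pi.single t 1, by simp [hai, Ne.symm hti],
      by simp only [Pi.add_apply]; omega, by rwa [hprod], by
        simp [Finset.sum_add_distrib]⟩
    have := Nat.le_findGreatest (hPle _ hP) hP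
    omega

/-- A generator not involving another variable is a pure power of `x t`, with exponent at least 2
since `x t ∉ I`. -/
theorem IsMonomialIdeal.le_span_sup (hx : IsRegularSystemOfParameters x)
    (hmon : IsMonomialIdeal x I) {t : Fin d} (ht : x t ∉ I) :
    I ≤ Ideal.span (x '' {t}ᶜ) ⊔ maximalIdeal Q ^ 2 := by
  obtain ⟨A, hA⟩ := hmon
  have hle := hA.ge
  rw [Ideal.span_le] at hle
  conv_lhs => rw [hA]
  rw [Ideal.span_le]
  rintro _ ⟨b, hb, rfl⟩
  have hbI : ∏ s, x s ^ b s ∈ I := hle ⟨b, hb, rfl⟩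
  by_cases h : ∃ s ≠ t, b s ≠ 0
  · obtain ⟨s, hst, hs⟩ := h
    refine Ideal.mem_sup_left (Ideal.mem_of_dvd _ ?_ (Ideal.subset_span ⟨s, hst, rfl⟩))
    exact (dvd_pow_self _ hs).trans
      (Finset.dvd_prod_of_mem (fun t => x t ^ b t) (Finset.mem_univ s))
  · push Not at h
    have hprod : ∏ s, x s ^ b s = x t ^ b t :=
      Finset.prod_eq_single t (fun s _ hs => by rw [h s hs, pow_zero]) (by simp)
    dsimp only
    rw [hprod] at hbI ⊢
    have h2 : 2 ≤ b t := by
      by_contra! hlt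
      exact ht (I.mem_of_dvd ((pow_dvd_pow (x t) (Nat.le_of_lt_succ hlt)).trans (by simp)) hbI)
    exact Ideal.mem_sup_right
      (Ideal.pow_le_pow_right h2 (Ideal.pow_mem_pow (hx.mem_maximalIdeal t) _))

theorem IsMonomialIdeal.mem_maximalIdeal_of_mul_add_mem (hx : IsRegularSystemOfParameters x)
    (hmon : IsMonomialIdeal x I) {t : Fin d} (ht : x t ∉ I) {u w : Q}
    (hw : w ∈ Ideal.span (x '' {t}ᶜ)) (h : u * x t + w ∈ maximalIdeal Q ^ 2 ⊔ I) :
    u ∈ maximalIdeal Q := by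
  apply hx.mem_maximalIdeal_of_mul_mem (t := t)
  rw [← add_sub_cancel_right (u * x t) w]
  exact Ideal.sub_mem _ ((sup_le le_sup_right (hmon.le_span_sup hx ht) :) h)
    (Ideal.mem_sup_left hw)

theorem IsLocalRing.mk_mem_maximalIdeal_pow_iff {A : Type u} [CommRing A] [IsLocalRing A]
    {J : Ideal A} [IsLocalRing (A ⧸ J)] {n : ℕ} {y : A} :
    Ideal.Quotient.mk J y ∈ maximalIdeal (A ⧸ J) ^ n ↔ y ∈ maximalIdeal A ^ n ⊔ J := by
  rw [← IsLocalRing.map_maximalIdeal_of_surjective (Ideal.Quotient.mk J)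
    Ideal.Quotient.mk_surjective, ← Ideal.map_pow, ← Ideal.mem_comap,
    Ideal.comap_map_of_surjective _ Ideal.Quotient.mk_surjective, ← RingHom.ker_eq_comap_bot,
    Ideal.mk_ker]

end MonomialIdeal

/-! ### Injective modules over Artinian local rings. -/

section Injective

variable {R : Type u} [CommRing R] [IsLocalRing R] [IsArtinianRing R]

theorem exists_socle_smul_ne_zero {M : Type u} [AddCommGroup M] [Module R M] {v : M}
    (hv : v ≠ 0) : ∃ r : R, r • v ≠ 0 ∧ ∀ a ∈ maximalIdeal R, a • r • v = 0 := by
  classical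
  obtain ⟨n, hn⟩ := IsArtinianRing.isNilpotent_jacobson_bot (R := R)
  rw [IsLocalRing.jacobson_eq_maximalIdeal _ bot_ne_top] at hn
  have hex : ∃ n, ∀ r ∈ maximalIdeal R ^ n, r • v = 0 :=
    ⟨n, fun r hr => by rw [hn] at hr; rw [(Submodule.mem_bot R).mp hr, zero_smul]⟩
  have hspec := Nat.find_spec hex
  obtain ⟨k, hk⟩ : ∃ k, Nat.find hex = k + 1 := by
    refine Nat.exists_eq_succ_of_ne_zero fun h0 => hv ?_
    simpa using hspec 1 (by rw [h0]; simp)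
  have := Nat.find_min hex (m := k) (by omega)
  push Not at this
  obtain ⟨r, hr, hrv⟩ := this
  refine ⟨r, hrv, fun a ha => ?_⟩
  rw [smul_smul]
  apply hspec
  rw [hk, pow_succ']
  exact Ideal.mul_mem_mul ha hr

/-- Choose `w` outside the domain with `𝔪 w` inside it. The map `a ↦ f (a * w)` on `𝔪` is
multiplication by some `m`, and `w ↦ m` extends `f`. -/
theorem exists_extension_of_notMem {M : Type u} [AddCommGroup M] [Module R M]
    (h : ∀ g : maximalIdeal R →ₗ[R] M, ∃ m : M, ∀ a : maximalIdeal R, g a = (a : R) • m)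
    (f : R →ₗ.[R] M) (hf : f.domain ≠ ⊤) : ∃ f' : R →ₗ.[R] M, f < f' := by
  have hq : ∃ v : R ⧸ f.domain, v ≠ 0 := by
    have := Submodule.Quotient.nontrivial_iff.mpr hf
    exact exists_ne 0
  obtain ⟨v, hv⟩ := hq
  obtain ⟨r, hrv, hann⟩ := exists_socle_smul_ne_zero (R := R) hv
  obtain ⟨w, hw⟩ := Submodule.Quotient.mk_surjective _ (r • v)
  rw [← hw] at hrv hann
  have hwJ : w ∉ f.domain := fun hmem => hrv ((Submodule.Quotient.mk_eq_zero _).mpr hmem)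
  have hmw : ∀ a ∈ maximalIdeal R, a * w ∈ f.domain := fun a ha => by
    have := hann a ha
    rwa [← Submodule.Quotient.mk_smul, Submodule.Quotient.mk_eq_zero] at this
  let g : maximalIdeal R →ₗ[R] M :=
    { toFun := fun a => f ⟨a * w, hmw a a.2⟩
      map_add' := fun a b => by
        rw [← LinearPMap.map_add]; congr 1; ext; simp [add_mul]
      map_smul' := fun c a => by
        rw [RingHom.id_apply, ← LinearPMap.map_smul]; congr 1; ext; simp [mul_assoc] }
  obtain ⟨m, hm⟩ := h g
  have hmem : ∀ c : R, c * w ∈ f.domain → c ∈ maximalIdeal R := fun c hc => by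
    rw [mem_maximalIdeal, mem_nonunits_iff]
    exact fun hu => hwJ ((Ideal.unit_mul_mem_iff_mem _ hu).mp hc)
  have hH : ∀ c : R, c • w = 0 → c • m = 0 := fun c hc => by
    rw [smul_eq_mul] at hc
    have hcm := hmem c (hc ▸ f.domain.zero_mem)
    rw [← hm ⟨c, hcm⟩]
    change f ⟨c * w, _⟩ = 0
    simp_rw [hc]
    exact f.map_zero
  let p : R →ₗ.[R] M := LinearPMap.mkSpanSingleton' w m hH
  have hcompat : ∀ (a : f.domain) (b : p.domain), (a : R) = b → f a = p b := by
    rintro ⟨a, ha⟩ ⟨b, hb⟩ rfl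
    obtain ⟨c, rfl⟩ := Submodule.mem_span_singleton.mp hb
    have h1 : p ⟨c • w, hb⟩ = c • m := LinearPMap.mkSpanSingleton'_apply _ _ _ _ _
    exact (hm ⟨c, hmem c ha⟩).trans h1.symm
  refine ⟨f.sup p hcompat, lt_of_le_of_ne (f.left_le_sup p hcompat) fun heq => hwJ ?_⟩
  rw [heq]
  exact (f.right_le_sup p hcompat).1 (Submodule.mem_span_singleton_self w)

/-- Over an Artinian local ring, Baer's criterion has to be checked on the maximal ideal only. -/
theorem Module.injective_of_maximalIdeal {M : Type u} [AddCommGroup M] [Module R M]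
    (h : ∀ g : maximalIdeal R →ₗ[R] M, ∃ m : M, ∀ a : maximalIdeal R, g a = (a : R) • m) :
    Module.Injective R M := by
  apply Module.Baer.injective
  intro J g
  have key : ∀ K : Ideal R, ∀ f : R →ₗ.[R] M, f.domain = K →
      ∃ f' : R →ₗ.[R] M, f ≤ f' ∧ f'.domain = ⊤ := by
    intro K
    induction K using WellFoundedGT.induction with
    | ind K ih =>
      intro f hf
      by_cases htop : f.domain = ⊤
      · exact ⟨f, le_rfl, htop⟩
      · obtain ⟨f₁, hf₁⟩ := exists_extension_of_notMem h f htop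
        have hlt : K < f₁.domain := by
          rw [← hf]
          refine lt_of_le_of_ne hf₁.le.1 fun heq => hf₁.ne ?_
          exact LinearPMap.eq_of_le_of_domain_eq hf₁.le heq
        obtain ⟨f', hf', htop'⟩ := ih _ hlt f₁ rfl
        exact ⟨f', hf₁.le.trans hf', htop'⟩
  obtain ⟨f', hf', htop⟩ := key J ⟨J, g⟩ rfl
  refine ⟨f'.toFun ∘ₗ LinearMap.codRestrict f'.domain LinearMap.id
    (fun y => htop ▸ Submodule.mem_top), fun y hy => ?_⟩
  exact (hf'.2 (x := ⟨y, hy⟩) rfl).symm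

/-- This converse direction needs the nonzero socle of `R`. A map `𝔪 → M` becomes multiplication by
some `u` in `E`, and `𝔪` kills `g u`. Injectivity of `C` makes `g u` a multiple of a socle element
`s`; lifting gives `u - s • c` in `M`, which acts on `𝔪` as `u` does. -/
theorem Module.injective_of_exact {M E C : Type u} [AddCommGroup M] [Module R M]
    [AddCommGroup E] [Module R E] [AddCommGroup C] [Module R C] (f : M →ₗ[R] E) (g : E →ₗ[R] C)
    (hf : Function.Injective f) (hfg : Function.Exact f g) (hg : Function.Surjective g)
    (hE : Module.Injective R E) (hC : Module.Injective R C) : Module.Injective R M := by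
  apply Module.injective_of_maximalIdeal
  intro φ
  obtain ⟨ψ, hψ⟩ := Module.Baer.of_injective hE _ (f ∘ₗ φ)
  obtain ⟨s, hs, hsm⟩ := exists_socle_smul_ne_zero (R := R) (one_ne_zero : (1 : R) ≠ 0)
  simp only [smul_eq_mul, mul_one] at hs hsm
  set u := ψ 1 with hu
  have hau : ∀ a (ha : a ∈ maximalIdeal R), a • u = f (φ ⟨a, ha⟩) := fun a ha => by
    rw [hu, ← map_smul, smul_eq_mul, mul_one]; exact hψ a ha
  obtain ⟨χ, hχ⟩ := Module.Baer.of_injective hC _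
    (LinearPMap.mkSpanSingleton' s (g u) fun c hc => by
      have hcm : c ∈ maximalIdeal R := by
        rw [mem_maximalIdeal, mem_nonunits_iff]
        exact fun hunit => hs (hunit.smul_eq_zero.mp hc)
      change c • g u = 0
      rw [← map_smul, hau c hcm]
      exact hfg.apply_apply_eq_zero _).toFun
  have hχs : χ s = g u := by
    rw [hχ s (Submodule.mem_span_singleton_self s)]
    exact LinearPMap.mkSpanSingleton'_apply_self _ _ _ _
  obtain ⟨c, hc⟩ := hg (χ 1)
  obtain ⟨m, hm⟩ := (hfg (u - s • c)).mp (by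
    rw [map_sub, map_smul, hc, ← map_smul, smul_eq_mul, mul_one, hχs, sub_self])
  refine ⟨m, fun a => hf ?_⟩
  rw [map_smul, hm, smul_sub, smul_smul, hsm a a.2, zero_smul, sub_zero, hau a a.2]

/-- Over an Artinian local ring, a module of finite injective dimension is injective. -/
theorem Module.injective_of_hasInjectiveDimensionLE (n : ℕ) :
    ∀ (M : Type u) [AddCommGroup M] [Module R M],
      HasInjectiveDimensionLE (ModuleCat.of R M) n → Module.Injective R M := by
  induction n with
  | zero =>
    intro M _ _ h
    rw [Module.injective_iff_injective_object, injective_iff_hasInjectiveDimensionLT_one]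
    exact h
  | succ n ih =>
    intro M _ _ h
    obtain ⟨E, hE, f, hf⟩ := EnoughInjectives.presentation (ModuleCat.of R M)
    have hinj : Function.Injective f.hom := (ModuleCat.mono_iff_injective f).mp hf
    let S : ShortComplex (ModuleCat.{u} R) :=
      ModuleCat.shortComplexOfCompEqZero _ _ f.hom.exact_map_mkQ_range.linearMap_comp_eq_zero
    have hS := ModuleCat.shortComplex_shortExact S
      f.hom.exact_map_mkQ_range hinj (Submodule.mkQ_surjective _)
    have hC := ih _ ((hS.hasInjectiveDimensionLT_X₃_iff n hE).mpr h)
    exact Module.injective_of_exact f.hom (Submodule.mkQ (LinearMap.range f.hom)) hinj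
      f.hom.exact_map_mkQ_range (Submodule.mkQ_surjective _)
      (Module.injective_module_of_injective_object R E) hC

theorem Module.Injective.exists_smul_eq_zero {M : Type u} [AddCommGroup M] [Module R M]
    [Nontrivial M] (hM : Module.Injective R M) {p s : R} (hs : s ∉ Ideal.span {p})
    (hsm : ∀ a ∈ maximalIdeal R, a * s = 0) :
    ∃ u : M, p • u = 0 ∧ u ∉ maximalIdeal R • (⊤ : Submodule R M) := by
  obtain ⟨v, hv⟩ := exists_ne (0 : M)
  obtain ⟨r, hr, hann⟩ := exists_socle_smul_ne_zero (R := R) hv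
  set w := r • v
  let q : (R ⧸ Ideal.span {p}) →ₗ.[R] M :=
    LinearPMap.mkSpanSingleton' (Ideal.Quotient.mk (Ideal.span {p}) s) w fun c hc => hann c <| by
      rw [mem_maximalIdeal, mem_nonunits_iff]
      intro hunit
      rw [hunit.smul_eq_zero] at hc
      exact hs (Ideal.Quotient.eq_zero_iff_mem.mp hc)
  obtain ⟨φ, hφ⟩ := (Module.Baer.of_injective hM).extension_property q.domain.subtype
    q.domain.injective_subtype q.toFun
  have hφs : s • φ 1 = w := by
    rw [← map_smul]
    have h1 : (s • 1 : R ⧸ Ideal.span {p}) = Ideal.Quotient.mk (Ideal.span {p}) s := by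
      rw [Algebra.smul_def, mul_one]; rfl
    rw [h1]
    have := LinearMap.congr_fun hφ ⟨_, Submodule.mem_span_singleton_self _⟩
    exact this.trans (LinearPMap.mkSpanSingleton'_apply_self _ _ _ _)
  refine ⟨φ 1, ?_, fun hmem => ?_⟩
  · rw [← map_smul]
    have h1 : (p • 1 : R ⧸ Ideal.span {p}) = 0 := by
      rw [Algebra.smul_def, mul_one]
      exact Ideal.Quotient.eq_zero_iff_mem.mpr (Ideal.mem_span_singleton_self p)
    rw [h1, map_zero]
  · apply hr
    rw [← hφs]
    refine Submodule.smul_induction_on hmem (fun a ha m _ => ?_) fun m m' h h' => ?_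
    · rw [smul_smul, mul_comm, hsm a ha, zero_smul]
    · rw [smul_add, h, h', add_zero]

end Injective

/-! ### Minimal free resolutions and the upper bound for Betti numbers. -/

section Resolution

variable {R : Type u} [CommRing R] [IsLocalRing R]

theorem mem_maximalIdeal_smul_top_iff {n : ℕ} {v : Fin n → R} :
    v ∈ maximalIdeal R • (⊤ : Submodule R (Fin n → R)) ↔ ∀ t, v t ∈ maximalIdeal R := by
  constructor
  · intro hv t
    refine Submodule.smul_induction_on hv (fun a ha w _ => ?_) fun v w hv hw => ?_
    · exact Ideal.mul_mem_right _ _ ha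
    · exact Ideal.add_mem _ hv hw
  · intro hv
    rw [pi_eq_sum_univ' v]
    exact Submodule.sum_mem _ fun t _ => Submodule.smul_mem_smul (hv t) trivial

/-- Every finite module over a local ring has a projective cover by a finite free module. -/
theorem exists_minimal_cover (M : Type u) [AddCommGroup M] [Module R M] [Module.Finite R M] :
    ∃ (n : ℕ) (f : (Fin n → R) →ₗ[R] M), Function.Surjective f ∧
      LinearMap.ker f ≤ maximalIdeal R • (⊤ : Submodule R (Fin n → R)) := by
  classical
  have hex := Module.Finite.exists_fin' R M
  obtain ⟨f, hf⟩ := Nat.find_spec hex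
  refine ⟨Nat.find hex, f, hf, fun v hv => ?_⟩
  rw [mem_maximalIdeal_smul_top_iff]
  intro t
  by_contra hcon
  have hu : IsUnit (v t) := by simpa using hcon
  have hmin := fun k => Nat.find_min hex (m := k)
  generalize Nat.find hex = n at *
  cases n with
  | zero => exact t.elim0
  | succ k =>
    -- A relation with unit coordinate at `t` makes the generator `t` redundant, contradicting the
    -- minimal number of generators.
    refine hmin k (Nat.lt_succ_self k)
      ⟨Fintype.linearCombination R fun s => f (Pi.single (t.succAbove s) 1), ?_⟩
    rw [← LinearMap.range_eq_top, Fintype.range_linearCombination, eq_top_iff]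
    set W := Submodule.span R (Set.range fun s => f (Pi.single (t.succAbove s) 1))
    have hW : ∀ s, f (Pi.single (t.succAbove s) 1) ∈ W := fun s => Submodule.subset_span ⟨s, rfl⟩
    have hfe : ∀ w, f w = ∑ s, w s • f (Pi.single s 1) := fun w => by
      conv_lhs => rw [pi_eq_sum_univ' w]
      simp
    have ht : f (Pi.single t 1) ∈ W := by
      have h0 := (hfe v).symm.trans hv
      rw [Fin.sum_univ_succAbove _ t] at h0
      rw [← Submodule.smul_mem_iff_of_isUnit _ hu, eq_neg_of_add_eq_zero_left h0]
      exact W.neg_mem (W.sum_mem fun s _ => W.smul_mem _ (hW s))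
    rintro m -
    obtain ⟨w, rfl⟩ := hf m
    rw [hfe, Fin.sum_univ_succAbove _ t]
    exact W.add_mem (W.smul_mem _ ht) (W.sum_mem fun s _ => W.smul_mem _ (hW s))

/-- The rank of a minimal free cover. -/
noncomputable def minimalCoverRank (M : Type u) [AddCommGroup M] [Module R M]
    [Module.Finite R M] : ℕ :=
  (exists_minimal_cover (R := R) M).choose

/-- A minimal free cover. -/
noncomputable def minimalCover (M : Type u) [AddCommGroup M] [Module R M] [Module.Finite R M] :
    (Fin (minimalCoverRank (R := R) M) → R) →ₗ[R] M :=
  (exists_minimal_cover (R := R) M).choose_spec.choose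

theorem minimalCover_surjective (M : Type u) [AddCommGroup M] [Module R M] [Module.Finite R M] :
    Function.Surjective (minimalCover (R := R) M) :=
  (exists_minimal_cover (R := R) M).choose_spec.choose_spec.1

theorem ker_minimalCover_le (M : Type u) [AddCommGroup M] [Module R M] [Module.Finite R M] :
    LinearMap.ker (minimalCover (R := R) M) ≤ maximalIdeal R • (⊤ : Submodule R _) :=
  (exists_minimal_cover (R := R) M).choose_spec.choose_spec.2

theorem range_subtype_comp_minimalCover {M : Type u} [AddCommGroup M] [Module R M]
    (N : Submodule R M) [Module.Finite R N] :
    LinearMap.range (N.subtype ∘ₗ minimalCover (R := R) N) = N := by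
  rw [LinearMap.range_comp, LinearMap.range_eq_top.mpr (minimalCover_surjective N),
    Submodule.map_top, Submodule.range_subtype]

theorem ker_subtype_comp_minimalCover {M : Type u} [AddCommGroup M] [Module R M]
    (N : Submodule R M) [Module.Finite R N] :
    LinearMap.ker (N.subtype ∘ₗ minimalCover (R := R) N) =
      LinearMap.ker (minimalCover (R := R) N) :=
  LinearMap.ker_comp_of_ker_eq_bot _ N.ker_subtype

/-- The successive syzygies of a module, as submodules of free modules. -/
noncomputable def syzygy [IsNoetherianRing R] (M : Type u) [AddCommGroup M] [Module R M]
    [Module.Finite R M] : ℕ → Σ r : ℕ, Submodule R (Fin r → R)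
  | 0 => ⟨_, LinearMap.ker (minimalCover (R := R) M)⟩
  | n + 1 => ⟨_, LinearMap.ker (minimalCover (R := R) (syzygy M n).2)⟩

theorem syzygy_le [IsNoetherianRing R] (M : Type u) [AddCommGroup M] [Module R M]
    [Module.Finite R M] : ∀ n : ℕ, (syzygy (R := R) M n).2 ≤ maximalIdeal R • ⊤
  | 0 => ker_minimalCover_le M
  | n + 1 => ker_minimalCover_le (syzygy (R := R) M n).2

/-- The differentials of the minimal free resolution through the syzygies. -/
noncomputable def syzygyDiff [IsNoetherianRing R] (M : Type u) [AddCommGroup M] [Module R M]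
    [Module.Finite R M] (i : ℕ) :
    (Fin (syzygy (R := R) M (i + 1)).1 → R) →ₗ[R] (Fin (syzygy (R := R) M i).1 → R) :=
  (syzygy (R := R) M i).2.subtype ∘ₗ minimalCover (R := R) (syzygy (R := R) M i).2

theorem range_syzygyDiff [IsNoetherianRing R] (M : Type u) [AddCommGroup M] [Module R M]
    [Module.Finite R M] (i : ℕ) :
    LinearMap.range (syzygyDiff (R := R) M i) = (syzygy (R := R) M i).2 := by
  exact range_subtype_comp_minimalCover _

theorem ker_syzygyDiff [IsNoetherianRing R] (M : Type u) [AddCommGroup M] [Module R M]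
    [Module.Finite R M] (i : ℕ) :
    LinearMap.ker (syzygyDiff (R := R) M i) = (syzygy (R := R) M (i + 1)).2 := by
  exact ker_subtype_comp_minimalCover _

theorem MinimalFreeResolution.nonempty [IsNoetherianRing R] (M : Type u) [AddCommGroup M]
    [Module R M] [Module.Finite R M] : Nonempty (MinimalFreeResolution R M) :=
  ⟨{ rank := fun i => (syzygy (R := R) M i).1
     diff := syzygyDiff M
     aug := minimalCover M
     aug_surjective := minimalCover_surjective M
     exact_aug := LinearMap.exact_iff.mpr (range_syzygyDiff M 0).symm
     exact_diff := fun i =>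
       LinearMap.exact_iff.mpr ((ker_syzygyDiff M i).trans (range_syzygyDiff M (i + 1)).symm)
     minimal := fun i => (range_syzygyDiff M i).trans_le (syzygy_le M i) }⟩

variable {M : Type u} [AddCommGroup M] [Module R M]

/-- The image of `f` surjects onto `(R ⧸ 𝔪) ^ m`, which has length `m`. -/
theorem le_length_range {m n : ℕ} (f : (Fin m → R) →ₗ[R] (Fin n → R))
    (hf : LinearMap.ker f ≤ maximalIdeal R • ⊤) :
    (m : ℕ∞) ≤ Module.length R (LinearMap.range f) := by
  let π : (Fin m → R) →ₗ[R] (Fin m → R ⧸ maximalIdeal R) :=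
    LinearMap.pi fun t => (Submodule.mkQ (maximalIdeal R)) ∘ₗ LinearMap.proj t
  have hπ : Function.Surjective π := fun v => by
    choose w hw using fun t => Submodule.mkQ_surjective (maximalIdeal R) (v t)
    exact ⟨w, funext hw⟩
  have hker : LinearMap.ker f ≤ LinearMap.ker π := fun v hv => by
    have := mem_maximalIdeal_smul_top_iff.mp (hf hv)
    exact LinearMap.mem_ker.mpr <| funext fun t => (Submodule.Quotient.mk_eq_zero _).mpr (this t)
  have hsimple : IsSimpleModule R (R ⧸ maximalIdeal R) :=
    isSimpleModule_iff_isCoatom.mpr (maximalIdeal.isMaximal R).out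
  have h1 : Module.length R (Fin m → R ⧸ maximalIdeal R) = m := by
    rw [Module.length_pi_of_fintype]
    simp [Module.length_eq_one]
  rw [← h1, ← (LinearMap.quotKerEquivRange f).length_eq]
  refine Module.length_le_of_surjective ((LinearMap.ker f).liftQ π hker) fun v => ?_
  obtain ⟨w, rfl⟩ := hπ v
  exact ⟨Submodule.Quotient.mk w, rfl⟩

theorem MinimalFreeResolution.ker_diff_le (F : MinimalFreeResolution R M) (i : ℕ) :
    LinearMap.ker (F.diff i) ≤ maximalIdeal R • ⊤ :=
  (LinearMap.exact_iff.mp (F.exact_diff i)).trans_le (F.minimal (i + 1))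

theorem MinimalFreeResolution.exists_rank_le [IsArtinianRing R] (F : MinimalFreeResolution R M) :
    ∃ c : ℕ, ∀ i, F.rank i ≤ F.rank 0 * c ^ i := by
  obtain ⟨c, hc⟩ := ENat.ne_top_iff_exists.mp (Module.length_ne_top (R := R) (M := R))
  refine ⟨c, fun i => ?_⟩
  induction i with
  | zero => simp
  | succ i ih =>
    have h1 := (le_length_range _ (F.ker_diff_le i)).trans
      (Module.length_le_of_injective (LinearMap.range (F.diff i)).subtype
        (LinearMap.range (F.diff i)).injective_subtype)
    rw [Module.length_pi_of_fintype, Finset.sum_const, Finset.card_univ, Fintype.card_fin, ← hc,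
      nsmul_eq_mul] at h1
    norm_cast at h1
    calc F.rank (i + 1) ≤ F.rank i * c := h1
      _ ≤ F.rank 0 * c ^ i * c := Nat.mul_le_mul_right _ ih
      _ = F.rank 0 * c ^ (i + 1) := by ring

end Resolution

/-! ### Doubling in the resolution and exponential growth. -/

section Growth

variable {R : Type u} [CommRing R] [IsLocalRing R]

/-- A family of vectors whose residues are linearly independent over the residue field. -/
def ResiduallyIndependent {ι : Type*} [Fintype ι] {n : ℕ} (e : ι → Fin n → R) : Prop :=
  ∀ c : ι → R, (∀ t, ∑ r, c r * e r t ∈ maximalIdeal R) → ∀ r, c r ∈ maximalIdeal R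

theorem ResiduallyIndependent.card_le {ι : Type*} [Fintype ι] {n : ℕ} {e : ι → Fin n → R}
    (he : ResiduallyIndependent e) : Fintype.card ι ≤ n := by
  have hli : LinearIndependent (ResidueField R) fun r t => residue R (e r t) := by
    rw [Fintype.linearIndependent_iff]
    intro g hg r
    choose c hc using fun r => residue_surjective (R := R) (g r)
    rw [← hc, residue_eq_zero_iff]
    refine he c (fun t => ?_) r
    rw [← residue_eq_zero_iff, map_sum]
    simpa [← hc] using congrFun hg t
  simpa using hli.fintype_card_le_finrank

variable {M : Type u} [AddCommGroup M] [Module R M]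

theorem MinimalFreeResolution.diff_mem (F : MinimalFreeResolution R M) (i : ℕ)
    (v : Fin (F.rank (i + 1)) → R) (t : Fin (F.rank i)) : F.diff i v t ∈ maximalIdeal R :=
  mem_maximalIdeal_smul_top_iff.mp (F.minimal i ⟨v, rfl⟩) t

theorem MinimalFreeResolution.diff_mem_sq (F : MinimalFreeResolution R M) (i : ℕ)
    {v : Fin (F.rank (i + 1)) → R} (hv : ∀ t, v t ∈ maximalIdeal R) (t : Fin (F.rank i)) :
    F.diff i v t ∈ maximalIdeal R ^ 2 := by
  rw [pi_eq_sum_univ' v]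
  simp only [map_sum, map_smul, Finset.sum_apply, Pi.smul_apply, smul_eq_mul]
  rw [pow_two]
  exact Ideal.sum_mem _ fun s _ => Ideal.mul_mem_mul (hv s) (F.diff_mem i _ t)

/-- Multiples by `p` of residually independent vectors that are boundaries come from residually
independent vectors. -/
theorem ResiduallyIndependent.of_diff_eq {ι : Type*} [Fintype ι] {i : ℕ}
    {F : MinimalFreeResolution R M} {p : R}
    (hp : ∀ u, u * p ∈ maximalIdeal R ^ 2 → u ∈ maximalIdeal R)
    {e : ι → Fin (F.rank i) → R} (he : ResiduallyIndependent e)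
    {f : ι → Fin (F.rank (i + 1)) → R} (hf : ∀ r, F.diff i (f r) = p • e r) :
    ResiduallyIndependent f := by
  intro c hc
  refine he c fun t => hp _ ?_
  -- A combination of the `f r` with entries in `𝔪` has differential in `𝔪²`; that differential is
  -- `p` times the same combination of the `e r`.
  have := F.diff_mem_sq i (v := ∑ r, c r • f r) (fun t => by simpa using hc t) t
  simp only [map_sum, map_smul, hf, Finset.sum_apply, Pi.smul_apply, smul_eq_mul] at this
  rw [Finset.sum_mul]
  convert this using 2
  ring

theorem ResiduallyIndependent.sumElim_of_diff_eq {ι : Type*} [Fintype ι] {i : ℕ}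
    {F : MinimalFreeResolution R M} {q r : R}
    (hqr : ∀ u v, u * q + v * r ∈ maximalIdeal R ^ 2 → u ∈ maximalIdeal R ∧ v ∈ maximalIdeal R)
    {e : ι → Fin (F.rank i) → R} (he : ResiduallyIndependent e)
    {g h : ι → Fin (F.rank (i + 1)) → R} (hg : ∀ s, F.diff i (g s) = q • e s)
    (hh : ∀ s, F.diff i (h s) = r • e s) : ResiduallyIndependent (Sum.elim g h) := by
  intro c hc
  have key : ∀ t, ∑ s, c (Sum.inl s) * e s t ∈ maximalIdeal R ∧
      ∑ s, c (Sum.inr s) * e s t ∈ maximalIdeal R := fun t => by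
    apply hqr
    have := F.diff_mem_sq i (v := ∑ s, c s • Sum.elim g h s) (fun t => by simpa using hc t) t
    rw [Fintype.sum_sum_type] at this
    simp only [Sum.elim_inl, Sum.elim_inr, map_add, map_sum, map_smul, hg, hh, Pi.add_apply,
      Finset.sum_apply, Pi.smul_apply, smul_eq_mul] at this
    rw [Finset.sum_mul, Finset.sum_mul]
    convert this using 3 <;> ring
  rintro (s | s)
  · exact he _ (fun t => (key t).1) s
  · exact he _ (fun t => (key t).2) s

theorem MinimalFreeResolution.exists_diff_eq (F : MinimalFreeResolution R M) {p q : R}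
    (hpq : p * q = 0) {i : ℕ} {v : Fin (F.rank i) → R} {f : Fin (F.rank (i + 1)) → R}
    (hf : F.diff i f = p • v) : ∃ g, F.diff (i + 1) g = q • f := by
  refine (F.exact_diff i (q • f)).mp ?_
  rw [map_smul, hf, smul_smul, mul_comm, hpq, zero_smul]

/-- If a minimal generator of `M` is killed by `p`, and `p` kills two elements that are linearly
independent modulo the square of the maximal ideal, then every second step of the minimal
resolution doubles the number of generators killed by `p`. -/
theorem MinimalFreeResolution.exists_residuallyIndependent (F : MinimalFreeResolution R M)
    {p q r : R} (hpq : p * q = 0) (hpr : p * r = 0)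
    (hp : ∀ u, u * p ∈ maximalIdeal R ^ 2 → u ∈ maximalIdeal R)
    (hqr : ∀ u v, u * q + v * r ∈ maximalIdeal R ^ 2 → u ∈ maximalIdeal R ∧ v ∈ maximalIdeal R)
    {u : M} (hpu : p • u = 0) (hu : u ∉ maximalIdeal R • (⊤ : Submodule R M)) (k : ℕ) :
    ∃ (ι : Type) (_ : Fintype ι) (e : ι → Fin (F.rank (2 * k)) → R)
      (f : ι → Fin (F.rank (2 * k + 1)) → R), Fintype.card ι = 2 ^ k ∧
      ResiduallyIndependent e ∧ ∀ s, F.diff (2 * k) (f s) = p • e s := by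
  induction k with
  | zero =>
    obtain ⟨e, he⟩ := F.aug_surjective u
    obtain ⟨f, hf⟩ := (F.exact_aug (p • e)).mp (by rw [map_smul, he, hpu])
    refine ⟨Unit, inferInstance, fun _ => e, fun _ => f, by simp, fun c hc s => ?_, fun _ => hf⟩
    by_contra hcon
    have hunit : IsUnit (c s) := by simpa using hcon
    apply hu
    rw [← he]
    have hmem : e ∈ maximalIdeal R • (⊤ : Submodule R (Fin (F.rank 0) → R)) := by
      rw [mem_maximalIdeal_smul_top_iff]
      intro t
      rw [← Ideal.unit_mul_mem_iff_mem _ hunit]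
      simpa using hc t
    have := Submodule.mem_map_of_mem (f := F.aug) hmem
    rw [Submodule.map_smul''] at this
    exact Submodule.smul_mono le_rfl le_top this
  | succ k ih =>
    obtain ⟨ι, hι, e, f, hcard, he, hf⟩ := ih
    -- `g` and `h` bound `q f` and `r f`; `g'` and `h'` bound `p g` and `p h`, restoring the
    -- hypothesis two degrees higher.
    have hfi := he.of_diff_eq hp hf
    choose g hg using fun s => F.exists_diff_eq hpq (hf s)
    choose h hh using fun s => F.exists_diff_eq hpr (hf s)
    have hgh := hfi.sumElim_of_diff_eq hqr hg hh
    choose g' hg' using fun s => F.exists_diff_eq (mul_comm p q ▸ hpq) (hg s)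
    choose h' hh' using fun s => F.exists_diff_eq (mul_comm p r ▸ hpr) (hh s)
    refine ⟨ι ⊕ ι, inferInstance, Sum.elim g h, Sum.elim g' h', ?_, hgh, ?_⟩
    · rw [Fintype.card_sum, hcard, pow_succ, mul_two]
    · rintro (s | s)
      · exact hg' s
      · exact hh' s

theorem MinimalFreeResolution.pow_le_rank (F : MinimalFreeResolution R M)
    {p q r : R} (hpq : p * q = 0) (hpr : p * r = 0)
    (hp : ∀ u, u * p ∈ maximalIdeal R ^ 2 → u ∈ maximalIdeal R)
    (hqr : ∀ u v, u * q + v * r ∈ maximalIdeal R ^ 2 → u ∈ maximalIdeal R ∧ v ∈ maximalIdeal R)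
    {u : M} (hpu : p • u = 0) (hu : u ∉ maximalIdeal R • (⊤ : Submodule R M)) (n : ℕ) :
    2 ^ (n / 2) ≤ F.rank n := by
  obtain ⟨ι, hι, e, f, hcard, he, hf⟩ :=
    F.exists_residuallyIndependent hpq hpr hp hqr hpu hu (n / 2)
  rw [← hcard]
  rcases Nat.even_or_odd' n with ⟨k, rfl | rfl⟩
  · rw [Nat.mul_div_cancel_left k two_pos] at e
    have := he.card_le
    rwa [Nat.mul_div_cancel_left k two_pos] at this
  · have := (he.of_diff_eq hp hf).card_le
    rwa [show 2 * ((2 * k + 1) / 2) + 1 = 2 * k + 1 by omega] at this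

theorem HasExponentialGrowth.of_bounds {b : ℕ → ℕ} {c : ℕ} (hlow : ∀ n, 2 ^ (n / 2) ≤ b n)
    (hup : ∀ n, b n ≤ b 0 * c ^ n) : HasExponentialGrowth b := by
  have hb0 : 1 ≤ b 0 := hlow 0
  have hlim : Filter.Tendsto (fun k : ℕ => ((25 / 18 : ℝ)) ^ k) Filter.atTop Filter.atTop :=
    tendsto_pow_atTop_atTop_of_one_lt (by norm_num)
  have hdiv : Filter.Tendsto (fun n : ℕ => n / 2) Filter.atTop Filter.atTop :=
    Nat.tendsto_div_const_atTop two_ne_zero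
  -- Any `α` with `1 < α < √2` would do. Here `2 / (6 / 5) ^ 2 = 25 / 18`, whose powers eventually
  -- absorb the extra factor `6 / 5` for odd `n`.
  refine ⟨6 / 5, (b 0 + 1) * (c + 1), by norm_num, ?_, ?_⟩
  · have h1 : (1 : ℝ) ≤ b 0 := by exact_mod_cast hb0
    have h2 : (0 : ℝ) ≤ c := c.cast_nonneg
    nlinarith
  · filter_upwards [(hlim.comp hdiv).eventually_gt_atTop (6 / 5), Filter.eventually_ge_atTop 1]
      with n hn hn1
    constructor
    · have h1 : ((6 / 5 : ℝ)) ^ n ≤ (6 / 5) ^ (2 * (n / 2) + 1) :=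
        pow_le_pow_right₀ (by norm_num) (by omega)
      have h2 : ((2 : ℝ)) ^ (n / 2) ≤ b n := by exact_mod_cast hlow n
      have h3 : ((6 / 5 : ℝ)) ^ (2 * (n / 2) + 1) = (36 / 25) ^ (n / 2) * (6 / 5) := by
        rw [pow_succ, pow_mul]; norm_num
      have h4 : ((36 / 25 : ℝ)) ^ (n / 2) * (25 / 18) ^ (n / 2) = 2 ^ (n / 2) := by
        rw [← mul_pow]; norm_num
      have h5 : (0 : ℝ) < (36 / 25) ^ (n / 2) := by positivity
      have h6 := mul_lt_mul_of_pos_left hn h5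
      simp only [Function.comp_apply] at h6
      linarith
    · have h1 : b 0 * c ^ n < (b 0 + 1) ^ n * (c + 1) ^ n := by
        have h2 : b 0 + 1 ≤ (b 0 + 1) ^ n := Nat.le_self_pow (by omega) _
        have h3 : c ^ n ≤ (c + 1) ^ n := Nat.pow_le_pow_left (Nat.le_succ c) n
        have h4 : 0 < (c + 1) ^ n := by positivity
        nlinarith
      rw [← mul_pow] at h1
      exact_mod_cast (hup n).trans_lt h1

end Growth

/-! ### The Artinian quotient and the main theorem. -/

theorem IsMaximalIdealPrimary.isArtinianRing_quotient {Q : Type u} [CommRing Q] [IsLocalRing Q]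
    [IsNoetherianRing Q] {I : Ideal Q} (h : IsMaximalIdealPrimary I) :
    IsArtinianRing (Q ⧸ I) := by
  have := h.isLocalRing_quotient
  obtain ⟨n, hn⟩ := I.exists_radical_pow_le_of_fg (IsNoetherian.noetherian _)
  rw [h.2] at hn
  refine (isArtinianRing_iff_isNilpotent_maximalIdeal (Q ⧸ I)).mpr ⟨n, ?_⟩
  rw [← IsLocalRing.map_maximalIdeal_of_surjective (Ideal.Quotient.mk I)
    Ideal.Quotient.mk_surjective, ← Ideal.map_pow, Ideal.zero_eq_bot, Ideal.map_eq_bot_iff_le_ker,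
    Ideal.mk_ker]
  exact hn

theorem mainTheorem7 (Q : Type u) [CommRing Q] [IsRegularLocalRing Q]
    (K : Type*) [Field K] [Algebra K Q]
    {d : ℕ} (x : Fin d → Q) (hx : IsRegularSystemOfParameters x)
    (I : Ideal Q) (hI : IsMaximalIdealPrimary I) (hmon : IsMonomialIdeal x I)
    (i j l : Fin d) (hjl : j ≠ l)
    (hij : x i * x j ∈ I) (hil : x i * x l ∈ I)
    (hi : x i ∉ I) (hj : x j ∉ I) (hl : x l ∉ I)
    (ω : Type u) [AddCommGroup ω] [Module (Q ⧸ I) ω] :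
    haveI : IsLocalRing (Q ⧸ I) := hI.isLocalRing_quotient
    IsCanonicalModule (Q ⧸ I) ω → GrowsExponentially (Q ⧸ I) ω := by
  have : IsLocalRing (Q ⧸ I) := hI.isLocalRing_quotient
  have : IsArtinianRing (Q ⧸ I) := hI.isArtinianRing_quotient
  intro hω
  obtain ⟨hfin, rs, -, hreg, -⟩ := hω.isMaximalCohenMacaulay
  have : Nontrivial ω := hreg.nontrivial
  obtain ⟨n, hn⟩ := hω.finite_injectiveDimension
  have hinj := Module.injective_of_hasInjectiveDimensionLE n ω hn
  obtain ⟨s, hs, hsm⟩ : ∃ s : Q, s ∉ Ideal.span {x i} ⊔ I ∧ ∀ y ∈ maximalIdeal Q, y * s ∈ I := by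
    by_cases h : i = l
    · exact hmon.exists_socle_notMem hx hI (fun hij => hjl (hij.symm.trans h)) hij hj
    · exact hmon.exists_socle_notMem hx hI h hil hl
  obtain ⟨u, hpu, hu⟩ := hinj.exists_smul_eq_zero
    (p := Ideal.Quotient.mk I (x i)) (s := Ideal.Quotient.mk I s)
    (by
      rw [← Set.image_singleton, ← Ideal.map_span, ← Ideal.mem_comap,
        Ideal.comap_map_of_surjective _ Ideal.Quotient.mk_surjective, ← RingHom.ker_eq_comap_bot,
        Ideal.mk_ker]
      exact hs)
    (by
      intro a ha
      obtain ⟨y, rfl⟩ := Ideal.Quotient.mk_surjective a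
      rw [← map_mul, Ideal.Quotient.eq_zero_iff_mem]
      refine hsm y ?_
      rw [mem_maximalIdeal, mem_nonunits_iff] at ha ⊢
      exact fun hy => ha (hy.map _))
  -- Applied to `j`, `l` in both orders this gives independence of `q`, `r` modulo `𝔪²`; with `b =
  -- 0` and any index other than `i` it gives the condition on `p`.
  have key : ∀ t t', x t ∉ I → t' ≠ t → ∀ a b : Q ⧸ I,
      a * Ideal.Quotient.mk I (x t) + b * Ideal.Quotient.mk I (x t') ∈
        maximalIdeal (Q ⧸ I) ^ 2 → a ∈ maximalIdeal (Q ⧸ I) := by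
    intro t t' ht htt' a b hab
    obtain ⟨a, rfl⟩ := Ideal.Quotient.mk_surjective a
    obtain ⟨b, rfl⟩ := Ideal.Quotient.mk_surjective b
    rw [← map_mul, ← map_mul, ← map_add, mk_mem_maximalIdeal_pow_iff] at hab
    have := hmon.mem_maximalIdeal_of_mul_add_mem hx ht
      (Ideal.mul_mem_left _ b (Ideal.subset_span ⟨t', htt', rfl⟩)) hab
    rw [← pow_one (maximalIdeal (Q ⧸ I)), mk_mem_maximalIdeal_pow_iff, pow_one]
    exact Ideal.mem_sup_left this
  have hne : ∃ t, t ≠ i := by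
    by_cases h : i = l
    · exact ⟨j, fun hji => hjl (hji.trans h)⟩
    · exact ⟨l, Ne.symm h⟩
  obtain ⟨t, ht⟩ := hne
  obtain ⟨F⟩ := MinimalFreeResolution.nonempty (R := Q ⧸ I) ω
  obtain ⟨c, hc⟩ := F.exists_rank_le
  refine ⟨F, HasExponentialGrowth.of_bounds (F.pow_le_rank (q := Ideal.Quotient.mk I (x j))
    (r := Ideal.Quotient.mk I (x l)) ?_ ?_ ?_ ?_ hpu hu) hc⟩
  · rw [← map_mul, Ideal.Quotient.eq_zero_iff_mem]; exact hij
  · rw [← map_mul, Ideal.Quotient.eq_zero_iff_mem]; exact hil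
  · intro a ha
    exact key i t hi ht a 0 (by rwa [zero_mul, add_zero])
  · intro a b hab
    exact ⟨key j l hj hjl.symm a b hab, key l j hl hjl b a (by rwa [add_comm])⟩
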